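/- All groups are finite and $p$ is a prime. **Definitions.** A fusion system $\mathcal F$ on a $p$-group $P$ is a category whose objects are the subgroups of $P$ and whose morphism sets $\mathrm{Hom}_{\mathcal F}(Q,R)$ consist of injective group homomorphisms (with the usual composition), such that all maps $Q\to R$ induced by conjugation by elements of $P$ are morphisms, every morphism $\varphi:Q\to R$ is also a morphism $Q\to Q\varphi$, and the inverse of every morphism that is a group isomorphism is a morphism. Write $\mathrm{Aut}_{\mathcal F}(Q)=\mathrm{Hom}_{\mathcal F}(Q,Q)$ and $\mathrm{Out}_{\mathcal F}(Q)=\mathrm{Aut}_{\mathcal F}(Q)/\mathrm{Inn}(Q)$. Let $\mathrm{Aut}_P(Q)$ be the group of automorphisms of $Q$ induced by conjugation by elements of $N_P(Q)$, and $\mathrm{Out}_P(Q)=\mathrm{Aut}_P(Q)/\mathrm{Inn}(Q)$. The $\mathcal F$-conjugates of $Q$ are the subgroups $Q\varphi$ with $\varphi\in\mathrm{Hom}_{\mathcal F}(Q,P)$. The subgroup $Q$ is *fully normalized* if $|N_P(Q)|\ge |N_P(R)|$ for all $\mathcal F$-conjugates $R$ of $Q$; it is *$\mathcal F$-centric* if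 $C_P(R)\le R$ for all $\mathcal F$-conjugates $R$ of $Q$; and it is *strongly $\mathcal F$-closed* if $x\varphi\in Q$ for all $x\in Q$ and $\varphi\in \mathrm{Hom}_{\mathcal F}(\langle x\rangle,P)$. For $\varphi\in\mathrm{Hom}_{\mathcal F}(Q,P)$ let $$N_\varphi(Q)=\{x\in N_P(Q)\mid \exists\, y\in N_P(Q\varphi)\text{ with }\varphi^{-1}c_x\varphi=c_y\text{ on }Q\varphi\},$$ where $c_x$ is conjugation by $x$. The subgroup $Q$ is *receptive* if every $\mathcal F$-isomorphism $\varphi:R\to Q$ (with $R\le P$) extends to an element of $\mathrm{Hom}_{\mathcal F}(N_\varphi(R),P)$. A proper subgroup $Q<P$ is *reproductive* if it is receptive and for each $\mathcal F$-conjugate $R$ of $Q$ there is $\psi\in\mathrm{Hom}_{\mathcal F}(R,Q)$ with $N_\psi(R)>R$. The subgroup $Q$ is *$\mathcal F$-essential* if it is reproductive and $\langle \varphi\in\mathrm{Aut}_{\mathcal F}(Q)\mid N_\varphi(Q)>Q\rangle$ is a proper subgroup of $\mathrm{Aut}_{\mathcal F}(Q)$. The fusion system $\mathcal F$ is *saturated*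 if $\mathrm{Aut}_P(P)\in\mathrm{Syl}_p(\mathrm{Aut}_{\mathcal F}(P))$ and every $\varphi\in\mathrm{Hom}_{\mathcal F}(Q,P)$ with $Q\varphi$ fully normalized extends to an element of $\mathrm{Hom}_{\mathcal F}(N_\varphi(Q),P)$. A fusion system $\mathcal E$ on $P$ is *semisaturated* if there are a $p$-group $S\ge P$ and a saturated fusion system $\mathcal F$ on $S$ such that $P$ is strongly $\mathcal F$-closed and $\mathrm{Hom}_{\mathcal E}(Q,R)=\mathrm{Hom}_{\mathcal F}(Q,R)$ for all $Q,R\le P$. For subgroups $D\le S$ of a group $G$, $D$ is *strongly closed* in $S$ with respect to $G$ if $x^g\in S$ with $x\in D$, $g\in G$ implies $x^g\in D$. Let $D>1$ be strongly closed in some Sylow $p$-subgroup of $G$ with respect to $G$. A proper subgroup $H$ of $G$ is *strongly $D$-embedded* in $G$ if $D^x\le H$ for some $x\in G$, and for all $g\in G\setminus H$ the subgroup $H\cap H^g$ contains no $G$-conjugate of any nontrivial subgroup of $D$. (Saying that $H$ is strongly $D$-embedded includes that $D$ is nontrivial and strongly closed in some Sylow $p$-subgroup of $G$.) **Statement.**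 Let $\mathcal E$ be a semisaturated fusion system on a $p$-group $P$ and let $Q\le P$ be fully normalized (with respect to $\mathcal E$). 1. If $Q$ is $\mathcal E$-essential, then: - (a) $Q$ is $\mathcal E$-centric; - (b) the subgroup $\langle \varphi\in \mathrm{Out}_{\mathcal E}(Q)\mid \mathrm{Out}_P(Q)\cap \mathrm{Out}_P(Q)^{\varphi}>1\rangle$ is strongly $\mathrm{Out}_P(Q)$-embedded in $\mathrm{Out}_{\mathcal E}(Q)$, and $\mathrm{Out}_P(Q)\cap O_p(\mathrm{Out}_{\mathcal E}(Q))=1$; - (c) $\mathrm{Inn}(Q)=\bigcap_{g\in G}D^g$, the core of $D$ in $G$, where $G=\mathrm{Aut}_{\mathcal E}(Q)$ and $D=\mathrm{Aut}_P(Q)$. 2. If $Q$ is $\mathcal E$-centric, then $Q$ is $\mathcal E$-essential if and only if $\mathrm{Out}_{\mathcal E}(Q)$ has a strongly $\mathrm{Out}_P(Q)$-embedded subgroup. -/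

import Mathlib

universe u

/-! ### Group-theoretic notions -/

section GroupTheory

variable {G : Type u} [Group G]

/-- The conjugate `D ^ g = g⁻¹ D g`. -/
def Subgroup.conjBy (D : Subgroup G) (g : G) : Subgroup G :=
  D.map (MulAut.conj g⁻¹).toMonoidHom

/-- `D ≤ S` is strongly closed in `S` with respect to `G`: whenever a `G`-conjugate of an element
of `D` lies in `S`, it lies in `D`. -/
def Subgroup.IsStronglyClosedIn (D S : Subgroup G) : Prop :=
  D ≤ S ∧ ∀ x ∈ D, ∀ g : G, g⁻¹ * x * g ∈ S → g⁻¹ * x * g ∈ D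

/-- `O_p(G)`, the subgroup generated by all normal `p`-subgroups of `G` (for finite `G`, the
largest normal `p`-subgroup). -/
def Subgroup.opCore (p : ℕ) (G : Type u) [Group G] : Subgroup G :=
  sSup {N : Subgroup G | N.Normal ∧ IsPGroup p N}

/-- `H` is strongly `D`-embedded in `G`, where `D > 1` is strongly closed in some Sylow
`p`-subgroup of `G` with respect to `G`. -/
structure Subgroup.IsStronglyEmbedded (p : ℕ) (D H : Subgroup G) : Prop where
  isStronglyClosedIn : ∃ S : Sylow p G, D.IsStronglyClosedIn (S : Subgroup G)
  ne_bot : D ≠ ⊥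
  ne_top : H ≠ ⊤
  exists_conj_le : ∃ x : G, D.conjBy x ≤ H
  not_conj_le : ∀ g : G, g ∉ H → ∀ U : Subgroup G, U ≤ D → U ≠ ⊥ → ∀ x : G,
    ¬ U.conjBy x ≤ H ⊓ H.conjBy g

/-- `Inn(G)` is normal in `Aut(G)`. -/
instance MulAut.normal_range_conj : (MulAut.conj : G →* MulAut G).range.Normal where
  conj_mem := by
    rintro _ ⟨g, rfl⟩ φ
    exact ⟨φ g, by ext x; simp [MulAut.conj_apply]⟩

/-- `Aut_P(Q)`, the group of automorphisms of `Q` induced by conjugation by elements of `N_P(Q)`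
(here `P` is the whole group). -/
def Subgroup.autByConj (Q : Subgroup G) : Subgroup (MulAut Q) :=
  Q.normalizerMonoidHom.range

/-- The image of a homomorphism `φ : Q → R` between subgroups of `G`, as a subgroup of `G`. -/
def Subgroup.imageOf {Q R : Subgroup G} (φ : Q →* R) : Subgroup G :=
  φ.range.map R.subtype

/-- `N_φ(Q)`: the elements `x` of `N_P(Q)` for which the automorphism `φ⁻¹ c_x φ` of `Qφ`
agrees with `c_y` for some `y ∈ N_P(Qφ)` (here `P` is the whole group). -/
def Subgroup.extNormalizer {Q R : Subgroup G} (φ : Q →* R) : Subgroup G where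
  carrier := {x | ∃ hx : x ∈ Subgroup.normalizer (Q : Set G),
    ∃ y ∈ Subgroup.normalizer (Subgroup.imageOf φ : Set G), ∀ u : Q,
      (φ (Q.normalizerMonoidHom ⟨x, hx⟩ u) : G) = y * (φ u : G) * y⁻¹}
  one_mem' := ⟨one_mem _, 1, one_mem _, fun u => by
    have h : (⟨1, one_mem _⟩ : Subgroup.normalizer (Q : Set G)) = 1 := rfl
    rw [h, map_one]; simp⟩
  mul_mem' := by
    rintro a b ⟨ha, y, hy, h⟩ ⟨hb, z, hz, k⟩
    refine ⟨mul_mem ha hb, y * z, mul_mem hy hz, fun u => ?_⟩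
    have e : (⟨a * b, mul_mem ha hb⟩ : Subgroup.normalizer (Q : Set G)) = ⟨a, ha⟩ * ⟨b, hb⟩ := rfl
    rw [e, map_mul, MulAut.mul_apply, h, k]
    group
  inv_mem' := by
    rintro a ⟨ha, y, hy, h⟩
    refine ⟨inv_mem ha, y⁻¹, inv_mem hy, fun u => ?_⟩
    have e : (⟨a⁻¹, inv_mem ha⟩ : Subgroup.normalizer (Q : Set G)) = ⟨a, ha⟩⁻¹ := rfl
    have := h (Q.normalizerMonoidHom ⟨a, ha⟩⁻¹ u)
    rw [← MulAut.mul_apply, ← map_mul, mul_inv_cancel, map_one, MulAut.one_apply] at this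
    rw [e, this]
    group

theorem Subgroup.le_extNormalizer {Q R : Subgroup G} (φ : Q →* R) :
    Q ≤ Subgroup.extNormalizer φ := by
  intro x hx
  refine ⟨Subgroup.le_normalizer hx, φ ⟨x, hx⟩, Subgroup.le_normalizer ?_, fun u => ?_⟩
  · exact ⟨φ ⟨x, hx⟩, ⟨_, rfl⟩, rfl⟩
  · have e : Q.normalizerMonoidHom ⟨x, Subgroup.le_normalizer hx⟩ u
        = ⟨x, hx⟩ * u * ⟨x, hx⟩⁻¹ := rfl
    rw [e, map_mul, map_mul, map_inv]
    rfl

end GroupTheory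

/-! ### Fusion systems -/

/-- A fusion system on a group `P`: the category whose objects are the subgroups of `P`, whose
morphisms are injective group homomorphisms, and which contains all maps induced by conjugation
in `P`, all restrictions of its morphisms to their images, and all inverses of its morphisms that
are isomorphisms. -/
structure FusionSystem (P : Type u) [Group P] where
  /-- The set of morphisms from `Q` to `R`. -/
  Hom (Q R : Subgroup P) : Set (Q →* R)
  injective_of_mem : ∀ {Q R : Subgroup P} {φ : Q →* R}, φ ∈ Hom Q R → Function.Injective φ
  conj_mem : ∀ {Q R : Subgroup P} (g : P) (φ : Q →* R),
    (∀ u : Q, (φ u : P) = g * (u : P) * g⁻¹) → φ ∈ Hom Q R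
  comp_mem : ∀ {Q R T : Subgroup P} {φ : Q →* R} {ψ : R →* T},
    φ ∈ Hom Q R → ψ ∈ Hom R T → ψ.comp φ ∈ Hom Q T
  image_mem : ∀ {Q R T : Subgroup P} {φ : Q →* R} (ψ : Q →* T), φ ∈ Hom Q R →
    (∀ u : Q, (ψ u : P) = (φ u : P)) → Function.Surjective ψ → ψ ∈ Hom Q T
  symm_mem : ∀ {Q R : Subgroup P} (e : Q ≃* R),
    e.toMonoidHom ∈ Hom Q R → e.symm.toMonoidHom ∈ Hom R Q

namespace FusionSystem

variable {P : Type u} [Group P] (F : FusionSystem P)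

/-- `R` is an `F`-conjugate of `Q`, i.e. `R ∈ Q ^ F`. -/
def IsConj (Q R : Subgroup P) : Prop :=
  ∃ φ ∈ F.Hom Q R, Subgroup.imageOf φ = R

/-- `Aut_F(Q)`. -/
def Aut (Q : Subgroup P) : Subgroup (MulAut Q) where
  carrier := {φ | φ.toMonoidHom ∈ F.Hom Q Q}
  one_mem' := F.conj_mem 1 _ fun u => by simp
  mul_mem' := fun ha hb => F.comp_mem hb ha
  inv_mem' := fun ha => F.symm_mem _ ha

/-- `Inn(Q)` as a subgroup of `Aut_F(Q)`. -/
def innAut (Q : Subgroup P) : Subgroup (F.Aut Q) :=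
  (MulAut.conj : Q →* MulAut Q).range.subgroupOf (F.Aut Q)

/-- `Aut_P(Q)` as a subgroup of `Aut_F(Q)`. -/
def autP (Q : Subgroup P) : Subgroup (F.Aut Q) :=
  Q.autByConj.subgroupOf (F.Aut Q)

instance normal_innAut (Q : Subgroup P) : (F.innAut Q).Normal :=
  MulAut.normal_range_conj.subgroupOf (F.Aut Q)

/-- `Out_F(Q) = Aut_F(Q) / Inn(Q)`. -/
abbrev Out (Q : Subgroup P) : Type u := F.Aut Q ⧸ F.innAut Q

/-- `Out_P(Q)`, the image of `Aut_P(Q)` in `Out_F(Q)`. -/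
def outP (Q : Subgroup P) : Subgroup (F.Out Q) :=
  (F.autP Q).map (QuotientGroup.mk' (F.innAut Q))

/-- `Q` is fully normalized: `|N_P(Q)| ≥ |N_P(R)|` for every `F`-conjugate `R` of `Q`. -/
def IsFullyNormalized (Q : Subgroup P) : Prop :=
  ∀ R : Subgroup P, F.IsConj Q R →
    Nat.card (Subgroup.normalizer (R : Set P)) ≤ Nat.card (Subgroup.normalizer (Q : Set P))

/-- `Q` is `F`-centric: `C_P(R) ≤ R` for every `F`-conjugate `R` of `Q`. -/
def IsCentric (Q : Subgroup P) : Prop :=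
  ∀ R : Subgroup P, F.IsConj Q R → Subgroup.centralizer (R : Set P) ≤ R

/-- `φ : Q → R` extends to a morphism in `Hom_F(N_φ(Q), P)`. -/
def Extends {Q R : Subgroup P} (φ : Q →* R) : Prop :=
  ∃ ψ ∈ F.Hom (Subgroup.extNormalizer φ) ⊤,
    ∀ u : Q, (ψ ⟨u, Subgroup.le_extNormalizer φ u.2⟩ : P) = (φ u : P)

/-- `F` is saturated: `Aut_P(P)` is a Sylow `p`-subgroup of `Aut_F(P)`, and every `F`-morphism
`φ : Q → P` with fully normalized image extends to an `F`-morphism `N_φ(Q) → P`. -/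
structure IsSaturated (p : ℕ) : Prop where
  sylow : ∃ T : Sylow p (F.Aut ⊤), (T : Subgroup (F.Aut ⊤)) = F.autP ⊤
  extend : ∀ (Q : Subgroup P), ∀ φ ∈ F.Hom Q ⊤,
    F.IsFullyNormalized (Subgroup.imageOf φ) → F.Extends φ

/-- `Q` is strongly `F`-closed: `xφ ∈ Q` for all `x ∈ Q` and `φ ∈ Hom_F(⟨x⟩, P)`. -/
def IsStronglyClosed (Q : Subgroup P) : Prop :=
  ∀ x ∈ Q, ∀ φ ∈ F.Hom (Subgroup.zpowers x) ⊤,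
    (φ ⟨x, Subgroup.mem_zpowers x⟩ : P) ∈ Q

/-- `E`, on `P`, is the restriction `F|_{≤ P}` of the fusion system `F` on an overgroup `S` of
`P`; the inclusion of `P` into `S` is an injective homomorphism `ι`. -/
def IsRestriction (E : FusionSystem P) {S : Type u} [Group S] (F : FusionSystem S)
    (ι : P →* S) : Prop :=
  ∀ (Q R : Subgroup P) (φ : Q →* R), φ ∈ E.Hom Q R ↔
    ∃ ψ ∈ F.Hom (Q.map ι) (R.map ι),
      ∀ u : Q, (ψ ⟨ι u, Subgroup.mem_map_of_mem ι u.2⟩ : S) = ι (φ u)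

/-- `E` is semisaturated: it is the restriction to `P` of a saturated fusion system `F` on a
finite `p`-group `S ≥ P` in which `P` is strongly `F`-closed. -/
def IsSemisaturated (p : ℕ) (E : FusionSystem P) : Prop :=
  ∃ (S : Type u) (_ : Group S) (_ : Finite S) (F : FusionSystem S) (ι : P →* S),
    IsPGroup p S ∧ Function.Injective ι ∧ F.IsSaturated p ∧
      F.IsStronglyClosed ι.range ∧ E.IsRestriction F ι

/-- `Q` is receptive: every `F`-isomorphism `φ : R → Q` extends to `N_φ(R) → P`. -/
def IsReceptive (Q : Subgroup P) : Prop :=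
  ∀ (R : Subgroup P) (φ : R ≃* Q), φ.toMonoidHom ∈ F.Hom R Q → F.Extends φ.toMonoidHom

/-- `R < P` is reproductive, i.e. `R ∈ F^r`. -/
structure IsReproductive (R : Subgroup P) : Prop where
  ne_top : R ≠ ⊤
  receptive : F.IsReceptive R
  exists_lt : ∀ Q : Subgroup P, F.IsConj R Q → ∃ ψ ∈ F.Hom Q R, Q < Subgroup.extNormalizer ψ

/-- `H_Q`, the subgroup of `Aut_F(Q)` generated by the `φ` with `N_φ(Q) > Q`. -/
def extAut (Q : Subgroup P) : Subgroup (F.Aut Q) :=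
  Subgroup.closure {φ | Q < Subgroup.extNormalizer (φ : MulAut Q).toMonoidHom}

/-- `Q` is `F`-essential: it is reproductive, and `H_Q` is proper in `Aut_F(Q)`. -/
structure IsEssential (Q : Subgroup P) : Prop where
  reproductive : F.IsReproductive Q
  extAut_ne_top : F.extAut Q ≠ ⊤

/-- The subgroup of `Out_F(Q)` generated by the `φ` with `Out_P(Q) ∩ Out_P(Q)^φ > 1`. -/
def intersectOut (Q : Subgroup P) : Subgroup (F.Out Q) :=
  Subgroup.closure {φ | F.outP Q ⊓ (F.outP Q).conjBy φ ≠ ⊥}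

end FusionSystem

/-! If `C_P(Q) ≤ Q`, an element of `N_P(Q)` induces an inner automorphism of `Q` only when it lies
in `Q`. Hence `N_φ(Q) > Q` says exactly that `Out_P(Q)` meets its conjugate under the class of `φ`
nontrivially (`lt_extNormalizer_iff`), and, when `Out_P(Q) > 1`, `extAut` is the full preimage of
`intersectOut`. If `C_P(Q)` is not contained in `Q`, it still lies in every `N_φ(Q)`, so `extAut` is
everything and `Q` is not essential. The rest of the argument in `Out_E(Q)` is group theory: for `D
> 1` strongly closed in a Sylow subgroup, the subgroup generated by the `g` with `D ∩ D^g > 1` is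
strongly `D`-embedded once it is proper, lies in a conjugate of every strongly `D`-embedded
subgroup, and is all of `G` if `D` meets `O_p(G)` nontrivially.

Semisaturation supplies the other inputs for fully normalized `Q`: `Out_P(Q)` is strongly closed in
a Sylow subgroup, isomorphisms `φ` onto `Q` extend to `N_φ`, and every conjugate `R` has an
isomorphism onto `Q` extending to `N_P(R)`. In the ambient saturated system `F` the last fact
combines the extension axiom with Sylow's theorem, since fully normalized subgroups are fully
automized (`IsSaturated.exists_sylow_eq_autP`). These facts descend to `E` because strong closure of
`P` turns `F`-maps on subgroups of `P` into `E`-maps, and because a fully `E`-normalized subgroup is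
carried, together with its normalizer in `P`, to one that is fully `F`-normalized
(`IsRestriction.exists_isoOn_normalizer_normalizer`). -/

/-! ### Isomorphisms of a fusion system as plain maps `P → P`, so that they compose and restrict
without casts -/

namespace FusionSystem

variable {P : Type u} [Group P] {F : FusionSystem P} {Q R T : Subgroup P} {f g : P → P}

/-- The map `f` restricts to an `F`-isomorphism from `Q` onto `R`. -/
def IsoOn (F : FusionSystem P) (Q R : Subgroup P) (f : P → P) : Prop :=
  ∃ e : Q ≃* R, e.toMonoidHom ∈ F.Hom Q R ∧ ∀ u : Q, f u = e u

theorem exists_isoOn_imageOf {φ : Q →* R} (hφ : φ ∈ F.Hom Q R) :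
    ∃ f, F.IsoOn Q (Subgroup.imageOf φ) f ∧ ∀ u : Q, f u = φ u := by
  let ψ : Q →* Subgroup.imageOf φ :=
    (R.subtype.comp φ).codRestrict _ fun u => ⟨φ u, ⟨u, rfl⟩, rfl⟩
  have hψ : ∀ u : Q, (ψ u : P) = φ u := fun u => rfl
  have hs : Function.Surjective ψ := by
    rintro ⟨_, _, ⟨u, rfl⟩, rfl⟩
    exact ⟨u, rfl⟩
  have hm : ψ ∈ F.Hom Q (Subgroup.imageOf φ) := F.image_mem ψ hφ hψ hs
  -- The value 1 off `Q` is a dummy: `IsoOn` only constrains the map on its source.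
  refine ⟨Function.extend Subtype.val (fun u : Q => (φ u : P)) (fun _ => 1),
    ⟨MulEquiv.ofBijective ψ ⟨F.injective_of_mem hm, hs⟩, hm, fun u => ?_⟩, fun u => ?_⟩
  · exact Subtype.val_injective.extend_apply _ _ u
  · exact Subtype.val_injective.extend_apply _ _ u

theorem exists_isoOn_of_equiv {e : Q ≃* R} (he : e.toMonoidHom ∈ F.Hom Q R) :
    ∃ f, F.IsoOn Q R f ∧ ∀ u : Q, f u = e u :=
  have h (u : Q) : Function.extend Subtype.val (fun u : Q => (e u : P)) (fun _ => 1) u = e u :=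
    Subtype.val_injective.extend_apply _ _ u
  ⟨_, ⟨e, he, h⟩, h⟩

theorem isoOn_conj (F : FusionSystem P) {x : P}
    (hx : ∀ u ∈ Q, x * u * x⁻¹ ∈ R) (hR : ∀ v ∈ R, x⁻¹ * v * x ∈ Q) :
    F.IsoOn Q R fun u => x * u * x⁻¹ := by
  refine ⟨{ toFun := fun u => ⟨x * u * x⁻¹, hx u u.2⟩
            invFun := fun v => ⟨x⁻¹ * v * x, hR v v.2⟩
            left_inv := fun u => ?_
            right_inv := fun u => ?_
            map_mul' := fun u v => ?_ }, F.conj_mem x _ fun u => rfl, fun u => rfl⟩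
  all_goals ext; simp [mul_assoc]

theorem isoOn_id (F : FusionSystem P) (Q : Subgroup P) : F.IsoOn Q Q id :=
  ⟨MulEquiv.refl _, F.conj_mem 1 _ fun u => by simp, fun u => rfl⟩

theorem imageOf_eq_of_surjective {φ : Q →* R} (h : Function.Surjective φ) :
    Subgroup.imageOf φ = R := by
  rw [Subgroup.imageOf, MonoidHom.range_eq_top.2 h, ← MonoidHom.range_eq_map, R.range_subtype]

namespace IsoOn

theorem mem (h : F.IsoOn Q R f) {x : P} (hx : x ∈ Q) : f x ∈ R := by
  obtain ⟨e, -, he⟩ := h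
  rw [he ⟨x, hx⟩]
  exact (e _).2

theorem map_mul (h : F.IsoOn Q R f) {x y : P} (hx : x ∈ Q) (hy : y ∈ Q) :
    f (x * y) = f x * f y := by
  obtain ⟨e, -, he⟩ := h
  have := he (⟨x, hx⟩ * ⟨y, hy⟩)
  rw [_root_.map_mul, Subgroup.coe_mul, Subgroup.coe_mul, ← he, ← he] at this
  exact this

theorem map_inv (h : F.IsoOn Q R f) {x : P} (hx : x ∈ Q) : f x⁻¹ = (f x)⁻¹ := by
  obtain ⟨e, -, he⟩ := h
  have := he (⟨x, hx⟩⁻¹)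
  rw [_root_.map_inv, Subgroup.coe_inv, Subgroup.coe_inv, ← he] at this
  exact this

theorem map_conj (h : F.IsoOn Q R f) {x y : P} (hx : x ∈ Q) (hy : y ∈ Q) :
    f (x * y * x⁻¹) = f x * f y * (f x)⁻¹ := by
  rw [h.map_mul (mul_mem hx hy) (inv_mem hx), h.map_mul hx hy, h.map_inv hx]

theorem injOn (h : F.IsoOn Q R f) {x y : P} (hx : x ∈ Q) (hy : y ∈ Q) (hxy : f x = f y) :
    x = y := by
  obtain ⟨e, -, he⟩ := h
  rw [he ⟨x, hx⟩, he ⟨y, hy⟩] at hxy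
  simpa using e.injective (Subtype.ext hxy)

theorem surj (h : F.IsoOn Q R f) {y : P} (hy : y ∈ R) : ∃ x ∈ Q, f x = y := by
  obtain ⟨e, -, he⟩ := h
  obtain ⟨x, hx⟩ := e.surjective ⟨y, hy⟩
  exact ⟨x, x.2, by rw [he, hx]⟩

theorem card_eq (h : F.IsoOn Q R f) : Nat.card Q = Nat.card R := by
  obtain ⟨e, -, -⟩ := h
  exact Nat.card_congr e.toEquiv

theorem congr (h : F.IsoOn Q R f) (hfg : ∀ x ∈ Q, g x = f x) : F.IsoOn Q R g := by
  obtain ⟨e, h1, he⟩ := h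
  exact ⟨e, h1, fun u => (hfg u u.2).trans (he u)⟩

theorem comp (hg : F.IsoOn R T g) (hf : F.IsoOn Q R f) : F.IsoOn Q T (g ∘ f) := by
  obtain ⟨e, h1, he⟩ := hf
  obtain ⟨e', h1', he'⟩ := hg
  exact ⟨e.trans e', F.comp_mem h1 h1', fun u => by simp [he, he']⟩

theorem symm (h : F.IsoOn Q R f) :
    ∃ g, F.IsoOn R Q g ∧ (∀ x ∈ Q, g (f x) = x) ∧ ∀ y ∈ R, f (g y) = y := by
  obtain ⟨e, h1, he⟩ := h
  obtain ⟨g, hg, hg'⟩ := exists_isoOn_of_equiv (F.symm_mem e h1)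
  refine ⟨g, hg, fun x hx => ?_, fun y hy => ?_⟩
  · rw [he ⟨x, hx⟩, hg', e.symm_apply_apply]
  · rw [hg' ⟨y, hy⟩, he, e.apply_symm_apply]

theorem restrict (h : F.IsoOn Q R f) (hT : T ≤ Q) : ∃ M ≤ R, F.IsoOn T M f := by
  obtain ⟨e, h1, he⟩ := h
  have h2 : e.toMonoidHom.comp (Subgroup.inclusion hT) ∈ F.Hom T R :=
    F.comp_mem (F.conj_mem 1 _ fun u => by simp) h1
  obtain ⟨g, hg, hg'⟩ := exists_isoOn_imageOf h2
  refine ⟨_, ?_, hg.congr fun x hx => ?_⟩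
  · rintro _ ⟨y, -, rfl⟩
    exact y.2
  · rw [hg' ⟨x, hx⟩]
    exact he ⟨x, hT hx⟩

/-- Conjugation by `y` corresponds under `f` to conjugation by `x`, which maps `Q` onto itself. Thus
the requirement `y ∈ N_P(Qφ)` in the definition of `N_φ(Q)` is automatic and is dropped from here
on. -/
theorem mem_normalizer (h : F.IsoOn Q R f) {x y : P}
    (hx : x ∈ Subgroup.normalizer (Q : Set P))
    (hxy : ∀ u ∈ Q, f (x * u * x⁻¹) = y * f u * y⁻¹) :
    y ∈ Subgroup.normalizer (R : Set P) := by
  rw [Subgroup.mem_normalizer_iff] at hx ⊢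
  intro r
  constructor
  · intro hr
    obtain ⟨u, hu, rfl⟩ := h.surj hr
    rw [← hxy u hu]
    exact h.mem ((hx u).1 hu)
  · intro hr
    obtain ⟨v, hv, hv'⟩ := h.surj hr
    have hu : x⁻¹ * v * x ∈ Q := (hx _).2 (by simpa [mul_assoc] using hv)
    have := hxy _ hu
    rw [show x * (x⁻¹ * v * x) * x⁻¹ = v by group, hv'] at this
    rw [mul_left_injective _ |>.eq_iff, mul_right_injective _ |>.eq_iff] at this
    rw [this]
    exact h.mem hu

theorem le_normalizer {N M : Subgroup P} (h : F.IsoOn N M f) (hQ : Q ≤ N)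
    (hN : N ≤ Subgroup.normalizer (Q : Set P)) (h' : F.IsoOn Q R f) :
    M ≤ Subgroup.normalizer (R : Set P) := by
  intro y hy
  obtain ⟨x, hx, rfl⟩ := h.surj hy
  exact h'.mem_normalizer (hN hx) fun u hu => h.map_conj hx (hQ hu)

theorem isConj (h : F.IsoOn Q R f) : F.IsConj Q R := by
  obtain ⟨e, h1, -⟩ := h
  exact ⟨_, h1, imageOf_eq_of_surjective e.surjective⟩

/-- An `F`-automorphism in the untyped sense, as an element of `Aut_F(Q)`. -/
theorem exists_aut (h : F.IsoOn Q Q f) : ∃ a : F.Aut Q, ∀ u : Q, ((a : MulAut Q) u : P) = f u := by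
  obtain ⟨e, h1, he⟩ := h
  exact ⟨⟨e, h1⟩, fun u => (he u).symm⟩

end IsoOn

theorem exists_isoOn_of_aut (a : F.Aut Q) :
    ∃ f, F.IsoOn Q Q f ∧ ∀ u : Q, f u = (a : MulAut Q) u :=
  exists_isoOn_of_equiv a.2

theorem isConj_iff : F.IsConj Q R ↔ ∃ f, F.IsoOn Q R f := by
  constructor
  · rintro ⟨φ, hφ, h⟩
    obtain ⟨f, hf, -⟩ := exists_isoOn_imageOf hφ
    rw [h] at hf
    exact ⟨f, hf⟩
  · rintro ⟨f, hf⟩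
    exact hf.isConj

theorem IsFullyNormalized.card_le (hQ : F.IsFullyNormalized Q) (h : F.IsoOn Q R f) :
    Nat.card (Subgroup.normalizer (R : Set P)) ≤ Nat.card (Subgroup.normalizer (Q : Set P)) :=
  hQ R h.isConj

theorem exists_isFullyNormalized [Finite P] (F : FusionSystem P) (Q : Subgroup P) :
    ∃ R f, F.IsFullyNormalized R ∧ F.IsoOn Q R f := by
  obtain ⟨R, hR, hmax⟩ := Set.exists_max_image {R | F.IsConj Q R}
    (fun R => Nat.card (Subgroup.normalizer (R : Set P))) (Set.toFinite _)
    ⟨Q, (F.isoOn_id Q).isConj⟩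
  obtain ⟨f, hf⟩ := isConj_iff.1 hR
  refine ⟨R, f, fun T hT => ?_, hf⟩
  obtain ⟨g, hg⟩ := isConj_iff.1 hT
  exact hmax T (hg.comp hf).isConj

theorem mem_autP_iff {a : F.Aut Q} : a ∈ F.autP Q ↔
    ∃ x ∈ Subgroup.normalizer (Q : Set P), ∀ u : Q, ((a : MulAut Q) u : P) = x * u * x⁻¹ := by
  constructor
  · rintro ⟨x, hx⟩
    refine ⟨x, x.2, fun u => ?_⟩
    have := congrArg (fun b : MulAut Q => (b u : P)) hx
    exact this.symm
  · rintro ⟨x, hx, h⟩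
    refine ⟨⟨x, hx⟩, ?_⟩
    ext u
    exact (h u).symm

theorem exists_mem_autP (F : FusionSystem P) {x : P}
    (hx : x ∈ Subgroup.normalizer (Q : Set P)) :
    ∃ a ∈ F.autP Q, ∀ u : Q, ((a : MulAut Q) u : P) = x * u * x⁻¹ := by
  have h := Subgroup.mem_normalizer_iff.1 hx
  obtain ⟨a, ha⟩ := (F.isoOn_conj (Q := Q) (R := Q) (x := x) (fun u hu => (h u).1 hu)
    fun v hv => (h _).2 (by simpa [mul_assoc] using hv)).exists_aut
  exact ⟨a, mem_autP_iff.2 ⟨x, hx, ha⟩, ha⟩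

theorem isPGroup_autP {p : ℕ} (hP : IsPGroup p P) (F : FusionSystem P) (Q : Subgroup P) :
    IsPGroup p (F.autP Q) := by
  have h : IsPGroup p Q.autByConj :=
    (hP.to_subgroup _).of_surjective _ Q.normalizerMonoidHom.rangeRestrict_surjective
  exact h.comap_of_injective _ Subtype.val_injective

theorem mem_extNormalizer_iff {e : Q ≃* R} (h1 : e.toMonoidHom ∈ F.Hom Q R)
    (he : ∀ u : Q, f u = e u) {x : P} :
    x ∈ Subgroup.extNormalizer e.toMonoidHom ↔ x ∈ Subgroup.normalizer (Q : Set P) ∧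
      ∃ y, ∀ u ∈ Q, f (x * u * x⁻¹) = y * f u * y⁻¹ := by
  constructor
  · rintro ⟨hx, y, -, hy⟩
    refine ⟨hx, y, fun u hu => ?_⟩
    rw [he ⟨u, hu⟩]
    exact (he _).trans (hy ⟨u, hu⟩)
  · rintro ⟨hx, y, hy⟩
    refine ⟨hx, y, ?_, fun u => ?_⟩
    · rw [imageOf_eq_of_surjective (φ := e.toMonoidHom) e.surjective]
      exact IsoOn.mem_normalizer (F := F) ⟨e, h1, he⟩ hx hy
    · exact (he _).symm.trans ((hy u u.2).trans (by rw [he u]; rfl))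

/-- The extension axiom of a saturated fusion system, for untyped isomorphisms. -/
theorem IsSaturated.exists_extension {p : ℕ} (hF : F.IsSaturated p) (hR : F.IsFullyNormalized R)
    (h : F.IsoOn Q R f) {N : Subgroup P} (hQ : Q ≤ N)
    (hN : N ≤ Subgroup.normalizer (Q : Set P))
    (hy : ∀ x ∈ N, ∃ y, ∀ u ∈ Q, f (x * u * x⁻¹) = y * f u * y⁻¹) :
    ∃ M g, F.IsoOn N M g ∧ ∀ u ∈ Q, g u = f u := by
  obtain ⟨e, h1, he⟩ := id h
  let φ : Q →* (⊤ : Subgroup P) := (Subgroup.inclusion le_top).comp e.toMonoidHom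
  have hφ : φ ∈ F.Hom Q ⊤ := F.comp_mem h1 (F.conj_mem 1 _ fun u => by simp)
  have hφf : ∀ u : Q, (φ u : P) = f u := fun u => (he u).symm
  have him : Subgroup.imageOf φ = R := by
    ext r
    constructor
    · rintro ⟨_, ⟨u, rfl⟩, rfl⟩
      exact (e u).2
    · intro hr
      obtain ⟨u, hu⟩ := e.surjective ⟨r, hr⟩
      exact ⟨φ u, ⟨u, rfl⟩, by simp [φ, hu]⟩
  obtain ⟨ψ, hψ, hψ'⟩ := hF.extend Q φ hφ (by rwa [him])
  obtain ⟨g, hg, hg'⟩ := exists_isoOn_imageOf hψ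
  have hNφ : N ≤ Subgroup.extNormalizer φ := by
    intro x hx
    obtain ⟨y, hy⟩ := hy x hx
    refine ⟨hN hx, y, ?_, fun u => ?_⟩
    · rw [him]
      exact h.mem_normalizer (hN hx) hy
    · rw [hφf, hφf, ← hy u u.2]
      rfl
  obtain ⟨M, -, hM⟩ := hg.restrict hNφ
  refine ⟨M, g, hM, fun u hu => ?_⟩
  rw [hg' ⟨u, hNφ (hQ hu)⟩]
  exact (hψ' ⟨u, hu⟩).trans (hφf _)

end FusionSystem

/-! ### Full automization in saturated fusion systems -/

theorem Sylow.exists_comap_equiv {p : ℕ} {G H : Type*} [Group G] [Group H] (θ : G ≃* H)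
    {A : Subgroup G} {B : Subgroup H} (h : ∀ a, a ∈ A ↔ θ a ∈ B) (T : Sylow p B) :
    ∃ T' : Sylow p A, ∀ a : A, a ∈ T' ↔ ⟨θ a, (h a).1 a.2⟩ ∈ T := by
  let ϕ : A →* B := (θ.toMonoidHom.comp A.subtype).codRestrict B fun a => (h a).1 a.2
  have hi : Function.Injective ϕ := fun a b hab =>
    Subtype.ext (θ.injective (congrArg Subtype.val hab))
  have hr : (T : Subgroup B) ≤ ϕ.range := by
    rintro ⟨b, hb⟩ -
    exact ⟨⟨θ.symm b, (h _).2 (by simpa using hb)⟩, Subtype.ext (θ.apply_symm_apply b)⟩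
  exact ⟨T.comapOfInjective ϕ hi hr, fun a => Iff.rfl⟩

namespace FusionSystem

variable {p : ℕ} {P : Type u} [Group P] {F : FusionSystem P} {Q R : Subgroup P} {f : P → P}

/-- If `Aut_S(R)` is a Sylow subgroup of `Aut_F(R)` and `e : Q ≃ R` identifies `Aut_E(Q)` with
`Aut_F(R)`, then the automorphisms of `Q` that become conjugations on `R` form a Sylow subgroup of
`Aut_E(Q)`. -/
theorem exists_sylow_of_equiv {E : FusionSystem P} {S : Type u} [Group S] {F : FusionSystem S}
    {Q : Subgroup P} {R : Subgroup S} (e : Q ≃* R)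
    (he : ∀ a : MulAut Q, a ∈ E.Aut Q ↔ MulAut.congr e a ∈ F.Aut R)
    (hR : ∃ T : Sylow p (F.Aut R), (T : Subgroup (F.Aut R)) = F.autP R) :
    ∃ T : Sylow p (E.Aut Q), ∀ a : E.Aut Q, a ∈ T ↔ ∃ y ∈ Subgroup.normalizer (R : Set S),
      ∀ u : Q, (e ((a : MulAut Q) u) : S) = y * e u * y⁻¹ := by
  obtain ⟨T, hT⟩ := hR
  obtain ⟨T', hT'⟩ := T.exists_comap_equiv (MulAut.congr e) he
  refine ⟨T', fun a => (hT' a).trans ?_⟩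
  rw [← SetLike.mem_coe, ← Sylow.coe_coe, SetLike.mem_coe, hT, mem_autP_iff]
  refine exists_congr fun y => and_congr_right fun _ => ?_
  constructor
  · intro h u
    simpa using h (e u)
  · intro h u
    simpa using h (e.symm u)

/-- The automorphisms of `Q` that `f` turns into conjugations form a Sylow subgroup; precomposing
`f` with an automorphism that conjugates `A` into it gives the required map. -/
theorem IsoOn.exists_isoOn_conj [Finite P] [Fact p.Prime] (h : F.IsoOn Q R f)
    (hR : ∃ T : Sylow p (F.Aut R), (T : Subgroup (F.Aut R)) = F.autP R)
    {A : Subgroup (F.Aut Q)} (hA : IsPGroup p A) :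
    ∃ g, F.IsoOn Q R g ∧ ∀ a ∈ A, ∃ y ∈ Subgroup.normalizer (R : Set P), ∀ u : Q,
      g ((a : MulAut Q) u) = y * g u * y⁻¹ := by
  obtain ⟨e, h1, he⟩ := id h
  have hiff : ∀ a : MulAut Q, a ∈ F.Aut Q ↔ MulAut.congr e a ∈ F.Aut R := by
    intro a
    constructor
    · exact fun ha => F.comp_mem (F.symm_mem e h1) (F.comp_mem (φ := a.toMonoidHom) ha h1)
    · intro ha
      have h2 := F.comp_mem (F.comp_mem (ψ := (MulAut.congr e a).toMonoidHom) h1 ha)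
        (F.symm_mem e h1)
      change a.toMonoidHom ∈ F.Hom Q Q
      convert h2 using 1
      ext u
      simp
  obtain ⟨T, hT⟩ := exists_sylow_of_equiv e hiff hR
  obtain ⟨T₁, hT₁⟩ := hA.exists_le_sylow
  obtain ⟨c, hc⟩ := MulAction.exists_smul_eq (F.Aut Q) T₁ T
  obtain ⟨k, hk, hk'⟩ := exists_isoOn_of_aut c
  refine ⟨f ∘ k, h.comp hk, fun a ha => ?_⟩
  have hca : c * a * c⁻¹ ∈ T := by
    rw [← hc]
    exact Subgroup.smul_mem_pointwise_smul a (MulAut.conj c) _ (hT₁ ha)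
  obtain ⟨y, hy, hy'⟩ := (hT _).1 hca
  refine ⟨y, hy, fun u => ?_⟩
  have := hy' ((c : MulAut Q) u)
  rw [← he, ← he] at this
  simpa [hk'] using this

/-- In a saturated fusion system, a fully normalized subgroup is fully automized. -/
theorem IsSaturated.exists_sylow_eq_autP [Finite P] [Fact p.Prime] (hP : IsPGroup p P)
    (hF : F.IsSaturated p) (Q : Subgroup P) (hQ : F.IsFullyNormalized Q) :
    ∃ T : Sylow p (F.Aut Q), (T : Subgroup (F.Aut Q)) = F.autP Q := by
  -- Downward induction on the order of `Q`, starting from the Sylow axiom at `P`.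
  induction hn : Nat.card P - Nat.card Q using Nat.strong_induction_on generalizing Q with
  | _ n ih =>
  by_cases hQt : Q = ⊤
  · subst hQt
    exact hF.sylow
  obtain ⟨T, hT⟩ := (isPGroup_autP hP F Q).exists_le_sylow
  refine ⟨T, ?_⟩
  by_contra hne
  have hlt : F.autP Q < T := lt_of_le_of_ne hT (Ne.symm hne)
  -- an automorphism outside `Aut_P(Q)` normalizing it
  obtain ⟨a, haT, haN, haQ⟩ : ∃ a ∈ T, (∀ b ∈ F.autP Q, a * b * a⁻¹ ∈ F.autP Q) ∧
      a ∉ F.autP Q := by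
    have : Group.IsNilpotent T := T.2.isNilpotent
    have h2 : (F.autP Q).subgroupOf T < ⊤ := by
      rw [lt_top_iff_ne_top, Ne, Subgroup.subgroupOf_eq_top]
      exact not_le_of_gt hlt
    obtain ⟨b, hb, hb'⟩ := SetLike.exists_of_lt (Group.normalizerCondition_of_isNilpotent _ h2)
    refine ⟨b, b.2, fun c hc => ?_, fun h => hb' (Subgroup.mem_subgroupOf.2 h)⟩
    exact ((Subgroup.mem_normalizer_iff.1 hb) ⟨c, hT hc⟩).1 hc
  obtain ⟨f, hf, hfa⟩ := exists_isoOn_of_aut a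
  let N := Subgroup.normalizer (Q : Set P)
  have hQN : Q ≤ N := Subgroup.le_normalizer
  -- Since `a` normalizes `Aut_P(Q)`, its `N_φ` is all of `N_P(Q)`. The extension stabilizes `Q`,
  -- hence is an automorphism of `N_P(Q)`.
  obtain ⟨M, g, hg, hgf⟩ := hF.exists_extension hQ hf hQN le_rfl fun x hx => by
    obtain ⟨b, hb, hbx⟩ := exists_mem_autP F hx
    obtain ⟨y, -, hby⟩ := mem_autP_iff.1 (haN b hb)
    refine ⟨y, fun u hu => ?_⟩
    have := hby ((a : MulAut Q) ⟨u, hu⟩)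
    rw [show x * u * x⁻¹ = ((b : MulAut Q) ⟨u, hu⟩ : P) from (hbx ⟨u, hu⟩).symm, hfa]
    rw [show f u = _ from hfa ⟨u, hu⟩, ← this]
    simp
  have hMN : M = N := Subgroup.eq_of_le_of_card_ge
    (hg.le_normalizer hQN le_rfl (hf.congr hgf)) hg.card_eq.le
  subst hMN
  obtain ⟨c, hc⟩ := hg.exists_aut
  have hcQ : ∀ (m : ℕ) (u : Q), (((c ^ m : F.Aut N) : MulAut N) ⟨u, hQN u.2⟩ : P)
      = ((a ^ m : F.Aut Q) : MulAut Q) u := by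
    intro m
    induction m with
    | zero => intro u; simp
    | succ m ihm =>
      intro u
      have h3 : (c : MulAut N) ⟨u, hQN u.2⟩ = ⟨(a : MulAut Q) u, hQN (Subtype.prop _)⟩ :=
        Subtype.ext ((hc _).trans ((hgf u u.2).trans (hfa u)))
      rw [pow_succ, pow_succ]
      simp only [Subgroup.coe_mul, MulAut.mul_apply, h3]
      exact ihm _
  -- replace `c` by a power of `p`-power order
  obtain ⟨m, hm, hcm⟩ : ∃ m, m.Coprime p ∧ IsPGroup p (Subgroup.zpowers (c ^ m)) := by
    have ho : orderOf c ≠ 0 := (orderOf_pos c).ne'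
    refine ⟨orderOf c / p ^ (orderOf c).factorization p,
      (Nat.coprime_ordCompl Fact.out ho).symm, ?_⟩
    refine IsPGroup.of_card (n := (orderOf c).factorization p) ?_
    rw [Nat.card_zpowers, orderOf_pow_of_dvd (Nat.ordCompl_pos p ho).ne'
      (Nat.ordCompl_dvd _ _)]
    exact Nat.div_div_self (Nat.ordProj_dvd _ _) ho
  -- `a` has `p`-power order and `m` is prime to `p`, so `a` is a power of `a ^ m`.
  have ham : a ^ m ∉ F.autP Q := by
    intro h
    obtain ⟨k, hk⟩ := T.2 ⟨a, haT⟩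
    have hk' : a ^ p ^ k = 1 := congrArg Subtype.val hk
    obtain ⟨l, hl⟩ := exists_pow_eq_self_of_coprime
      ((hm.pow_right k).coprime_dvd_right (orderOf_dvd_of_pow_eq_one hk'))
    exact haQ (hl ▸ pow_mem h l)
  apply ham
  obtain ⟨L, k, hL, hk⟩ := F.exists_isFullyNormalized N
  have hQltN : Q < N := by
    have : Group.IsNilpotent P := hP.isNilpotent
    exact Group.normalizerCondition_of_isNilpotent Q (lt_top_iff_ne_top.2 hQt)
  have hcard : Nat.card Q < Nat.card N :=
    lt_of_not_ge fun h => hQltN.ne (Subgroup.eq_of_le_of_card_ge hQltN.le h)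
  have hsyl := ih (Nat.card P - Nat.card L) (by
    have := N.card_le_card_group
    rw [← hk.card_eq]
    omega) L hL rfl
  -- By induction `L` is fully automized, so some isomorphism `N → L` turns the `p`-element `c ^ m`
  -- into conjugation by an element `y`.
  obtain ⟨k', hk', hconj⟩ := hk.exists_isoOn_conj hsyl hcm
  obtain ⟨y, -, hy'⟩ := hconj _ (Subgroup.mem_zpowers _)
  obtain ⟨Q₁, hQ₁L, hQ₁⟩ := hk'.restrict hQN
  -- Full normalization of `Q` bounds `|N_P(Q₁)|` by `|N| = |L|`. As `y` normalizes `Q₁`, it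
  -- therefore lies in `L` and pulls back to an element of `N` inducing `a ^ m`, a contradiction.
  have hLN : L = Subgroup.normalizer (Q₁ : Set P) :=
    Subgroup.eq_of_le_of_card_ge (hk'.le_normalizer hQN le_rfl hQ₁)
      ((hQ.card_le hQ₁).trans hk'.card_eq.le)
  obtain ⟨d, hd, hdc⟩ := exists_isoOn_of_aut (a ^ m)
  have hyc : ∀ u : Q, k' (((a ^ m : F.Aut Q) : MulAut Q) u) = y * k' u * y⁻¹ := fun u => by
    rw [← hcQ]
    exact hy' ⟨u, hQN u.2⟩
  have hyL : y ∈ L := by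
    rw [hLN]
    have h4 : F.IsoOn Q Q₁ (k' ∘ d) := hQ₁.comp hd
    rw [Subgroup.mem_normalizer_iff]
    intro r
    constructor
    · intro hr
      obtain ⟨u, hu, rfl⟩ := hQ₁.surj hr
      rw [← hyc ⟨u, hu⟩]
      exact hQ₁.mem (Subtype.prop _)
    · intro hr
      obtain ⟨u, hu, hu'⟩ := h4.surj hr
      rw [Function.comp_apply, hdc ⟨u, hu⟩, hyc ⟨u, hu⟩] at hu'
      have : r = k' u := by simpa using hu'.symm
      rw [this]
      exact hQ₁.mem hu
  obtain ⟨x, hx, rfl⟩ := hk'.surj hyL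
  refine mem_autP_iff.2 ⟨x, hx, fun u => ?_⟩
  refine hk'.injOn (hQN (Subtype.prop _)) (mul_mem (mul_mem hx (hQN u.2)) (inv_mem hx)) ?_
  rw [hyc, hk'.map_conj hx (hQN u.2)]

/-- In a saturated fusion system every conjugate `Q` of a fully normalized subgroup `R` has an
isomorphism onto `R` that extends to the normalizer of `Q`. -/
theorem IsSaturated.exists_isoOn_normalizer [Finite P] [Fact p.Prime] (hP : IsPGroup p P)
    (hF : F.IsSaturated p) (hR : F.IsFullyNormalized R) (h : F.IsoOn Q R f) :
    ∃ M g, F.IsoOn (Subgroup.normalizer (Q : Set P)) M g ∧ F.IsoOn Q R g ∧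
      M ≤ Subgroup.normalizer (R : Set P) := by
  obtain ⟨k, hk, hconj⟩ := h.exists_isoOn_conj (hF.exists_sylow_eq_autP hP R hR)
    (isPGroup_autP hP F Q)
  obtain ⟨M, g, hg, hgk⟩ := hF.exists_extension hR hk Subgroup.le_normalizer le_rfl fun x hx => by
    obtain ⟨b, hb, hbx⟩ := exists_mem_autP F hx
    obtain ⟨y, -, hy⟩ := hconj b hb
    refine ⟨y, fun u hu => ?_⟩
    rw [← hy ⟨u, hu⟩, hbx]
  exact ⟨M, g, hg, hk.congr hgk, hg.le_normalizer Subgroup.le_normalizer le_rfl (hk.congr hgk)⟩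

end FusionSystem

/-! ### Descent from a saturated system to a strongly closed subgroup -/

namespace FusionSystem

variable {p : ℕ} {P : Type u} [Group P] {E : FusionSystem P} {Q R : Subgroup P} {f g : P → P}

theorem IsStronglyClosed.mem_of_isoOn {T : Subgroup P} (hT : E.IsStronglyClosed T)
    (h : E.IsoOn Q R f) {x : P} (hxQ : x ∈ Q) (hxT : x ∈ T) : f x ∈ T := by
  obtain ⟨M, -, e, h1, he⟩ := h.restrict ((Subgroup.zpowers_le (H := Q)).2 hxQ)
  have := hT x hxT ((Subgroup.inclusion le_top).comp e.toMonoidHom)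
    (E.comp_mem h1 (E.conj_mem 1 _ fun u => by simp))
  rw [he ⟨x, Subgroup.mem_zpowers x⟩]
  exact this

theorem apply_mem_normalizer_map_iff {S : Type u} [Group S] {ι : P →* S}
    (hι : Function.Injective ι) {x : P} :
    ι x ∈ Subgroup.normalizer (Q.map ι : Set S) ↔ x ∈ Subgroup.normalizer (Q : Set P) := by
  have := Subgroup.comap_normalizer_eq_of_le_range (f := ι) (H := Q.map ι) (Subgroup.map_le_range ι Q)
  rw [Subgroup.comap_map_eq_self_of_injective hι] at this
  rw [← this]
  rfl

section Restriction

variable {S : Type u} [Group S] {F : FusionSystem S} {ι : P →* S}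

theorem IsRestriction.exists_isoOn_map (hE : E.IsRestriction F ι) (h : E.IsoOn Q R g) :
    ∃ f, F.IsoOn (Q.map ι) (R.map ι) f ∧ ∀ x ∈ Q, f (ι x) = ι (g x) := by
  obtain ⟨e, h1, he⟩ := h
  obtain ⟨ψ, hψ, hψ'⟩ := (hE _ _ _).1 h1
  obtain ⟨f, hf, hfψ⟩ := exists_isoOn_imageOf hψ
  have hs : Function.Surjective ψ := by
    rintro ⟨_, r, hr, rfl⟩
    obtain ⟨u, hu⟩ := e.surjective ⟨r, hr⟩
    refine ⟨⟨ι u, Subgroup.mem_map_of_mem ι u.2⟩, Subtype.ext ((hψ' u).trans ?_)⟩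
    simp [hu]
  rw [imageOf_eq_of_surjective hs] at hf
  refine ⟨f, hf, fun x hx => ?_⟩
  rw [hfψ ⟨ι x, Subgroup.mem_map_of_mem ι hx⟩, hψ' ⟨x, hx⟩, he ⟨x, hx⟩]
  rfl

/-- Strong closure forces the image of a subgroup of `P` back into `P`, so an `F`-isomorphism
leaving it is already an `E`-isomorphism. -/
theorem IsRestriction.exists_isoOn_of_map (hE : E.IsRestriction F ι)
    (hι : Function.Injective ι) (hcl : F.IsStronglyClosed ι.range) {R' : Subgroup S} {f : S → S}
    (h : F.IsoOn (Q.map ι) R' f) :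
    ∃ R g, R.map ι = R' ∧ E.IsoOn Q R g ∧ ∀ x ∈ Q, f (ι x) = ι (g x) := by
  have hg : ∀ x, ∃ y, x ∈ Q → f (ι x) = ι y := fun x => by
    by_cases hx : x ∈ Q
    · obtain ⟨y, hy⟩ := hcl.mem_of_isoOn h (Subgroup.mem_map_of_mem ι hx) ⟨x, rfl⟩
      exact ⟨y, fun _ => hy.symm⟩
    · exact ⟨1, fun hx' => absurd hx' hx⟩
  choose g hg using hg
  have hR : (R'.comap ι).map ι = R' := by
    refine Subgroup.map_comap_eq_self ?_
    intro y hy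
    obtain ⟨_, ⟨x, hx, rfl⟩, rfl⟩ := h.surj hy
    exact ⟨g x, (hg x hx).symm⟩
  generalize hRdef : R'.comap ι = R at hR
  subst hR
  have hgR : ∀ x ∈ Q, g x ∈ R := fun x hx => by
    have := h.mem (Subgroup.mem_map_of_mem ι hx)
    rw [hg x hx] at this
    rwa [← Subgroup.comap_map_eq_self_of_injective hι R]
  let φ : Q →* R := MonoidHom.mk' (fun u => ⟨g u, hgR u u.2⟩) fun u v => by
    apply Subtype.ext
    apply hι
    change ι (g (u * v)) = ι (g u * g v)
    rw [map_mul, ← hg _ u.2, ← hg _ v.2, ← hg _ (mul_mem u.2 v.2), map_mul,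
      h.map_mul (Subgroup.mem_map_of_mem ι u.2) (Subgroup.mem_map_of_mem ι v.2)]
  obtain ⟨e, h1, he⟩ := id h
  have hφ : φ ∈ E.Hom Q R := (hE _ _ _).2 ⟨_, h1, fun u => (he _).symm.trans (hg u u.2)⟩
  have hs : Function.Surjective φ := by
    rintro ⟨r, hr⟩
    obtain ⟨_, ⟨x, hx, rfl⟩, hxr⟩ := h.surj (Subgroup.mem_map_of_mem ι hr)
    rw [hg x hx] at hxr
    exact ⟨⟨x, hx⟩, Subtype.ext (hι hxr)⟩
  exact ⟨R, g, rfl, ⟨MulEquiv.ofBijective φ ⟨E.injective_of_mem hφ, hs⟩, hφ, fun u => rfl⟩, hg⟩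

theorem IsRestriction.exists_extension (hE : E.IsRestriction F ι)
    (hι : Function.Injective ι) (hcl : F.IsStronglyClosed ι.range)
    (hF : F.IsSaturated p) (hR : F.IsFullyNormalized (R.map ι))
    (h : E.IsoOn Q R f) {N : Subgroup P} (hQ : Q ≤ N)
    (hN : N ≤ Subgroup.normalizer (Q : Set P))
    (hy : ∀ x ∈ N, ∃ y, ∀ u ∈ Q, f (x * u * x⁻¹) = y * f u * y⁻¹) :
    ∃ M g, E.IsoOn N M g ∧ ∀ u ∈ Q, g u = f u := by
  obtain ⟨f', hf', hff'⟩ := hE.exists_isoOn_map h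
  obtain ⟨M', k, hk, hkf⟩ := hF.exists_extension hR hf' (Subgroup.map_mono hQ)
    (N := N.map ι) (by
      rintro _ ⟨x, hx, rfl⟩
      exact (apply_mem_normalizer_map_iff hι).2 (hN hx)) (by
    rintro _ ⟨x, hx, rfl⟩
    obtain ⟨y, hy⟩ := hy x hx
    refine ⟨ι y, ?_⟩
    rintro _ ⟨u, hu, rfl⟩
    have hxu : x * u * x⁻¹ ∈ Q := (Subgroup.mem_normalizer_iff.1 (hN hx) u).1 hu
    rw [hff' u hu, ← map_inv ι x, ← map_mul, ← map_mul, hff' _ hxu, hy u hu]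
    simp)
  obtain ⟨M, g, -, hg, hgk⟩ := hE.exists_isoOn_of_map hι hcl hk
  exact ⟨M, g, hg, fun u hu => hι <| by
    rw [← hgk u (hQ hu), hkf _ (Subgroup.mem_map_of_mem ι hu), hff' u hu]⟩

variable [Finite S] [Fact p.Prime]

theorem IsRestriction.exists_isoOn_normalizer (hE : E.IsRestriction F ι)
    (hι : Function.Injective ι) (hcl : F.IsStronglyClosed ι.range) (hS : IsPGroup p S)
    (hF : F.IsSaturated p) {R' : Subgroup S} (hR : F.IsFullyNormalized R') {f : S → S}
    (h : F.IsoOn (Q.map ι) R' f) :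
    ∃ R M g, R.map ι = R' ∧ E.IsoOn (Subgroup.normalizer (Q : Set P)) M g ∧ E.IsoOn Q R g ∧
      M ≤ Subgroup.normalizer (R : Set P) := by
  obtain ⟨M', k, hk, hkQ, -⟩ := hF.exists_isoOn_normalizer hS hR h
  have hN : (Subgroup.normalizer (Q : Set P)).map ι ≤ Subgroup.normalizer (Q.map ι : Set S) := by
    rintro _ ⟨x, hx, rfl⟩
    exact (apply_mem_normalizer_map_iff hι).2 hx
  obtain ⟨L', -, hL'⟩ := hk.restrict hN
  obtain ⟨M, g, -, hg, hgk⟩ := hE.exists_isoOn_of_map hι hcl hL'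
  obtain ⟨R, g', hR', hg', hgk'⟩ := hE.exists_isoOn_of_map hι hcl hkQ
  have hgR : E.IsoOn Q R g := hg'.congr fun x hx => hι <| by
    rw [← hgk x (Subgroup.le_normalizer hx), ← hgk' x hx]
  exact ⟨R, M, g, hR', hg, hgR, hg.le_normalizer Subgroup.le_normalizer le_rfl hgR⟩

/-- A fully normalized subgroup of `E` is conjugate, by an isomorphism between normalizers, to one
that is fully normalized in the saturated fusion system `F`. -/
theorem IsRestriction.exists_isoOn_normalizer_normalizer [Finite P] (hE : E.IsRestriction F ι)
    (hι : Function.Injective ι) (hcl : F.IsStronglyClosed ι.range) (hS : IsPGroup p S)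
    (hF : F.IsSaturated p) (hQ : E.IsFullyNormalized Q) :
    ∃ R g, F.IsFullyNormalized (R.map ι) ∧ E.IsoOn Q R g ∧
      E.IsoOn (Subgroup.normalizer (Q : Set P)) (Subgroup.normalizer (R : Set P)) g := by
  obtain ⟨R', f, hR', hf⟩ := F.exists_isFullyNormalized (Q.map ι)
  obtain ⟨R, M, g, rfl, hg, hgQ, hM⟩ := hE.exists_isoOn_normalizer hι hcl hS hF hR' hf
  -- `M ≤ N_P(R)`, and full normalization of `Q` in `E` gives `|N_P(R)| ≤ |N_P(Q)| = |M|`.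
  have := Subgroup.eq_of_le_of_card_ge hM ((hQ.card_le hgQ).trans hg.card_eq.le)
  exact ⟨R, g, hR', hgQ, this ▸ hg⟩

end Restriction

variable [Finite P] [Fact p.Prime]

namespace IsSemisaturated

/-- Extend the passage from `R` to an `F`-fully normalized conjugate `T` of `Q`, then return along
the isomorphism between `N_P(Q)` and `N_P(T)`. -/
theorem exists_isoOn_normalizer (hE : E.IsSemisaturated p) (hQ : E.IsFullyNormalized Q)
    (h : E.IsoOn R Q f) : ∃ M g, E.IsoOn (Subgroup.normalizer (R : Set P)) M g ∧
      E.IsoOn R Q g ∧ M ≤ Subgroup.normalizer (Q : Set P) := by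
  obtain ⟨S, _, _, F, ι, hS, hι, hF, hcl, hres⟩ := hE
  obtain ⟨T, g, hT, hgQ, hg⟩ := hres.exists_isoOn_normalizer_normalizer hι hcl hS hF hQ
  obtain ⟨f', hf', -⟩ := hres.exists_isoOn_map (hgQ.comp h)
  obtain ⟨T', M, k, hT', hk, hkR, hM⟩ := hres.exists_isoOn_normalizer hι hcl hS hF hT hf'
  obtain rfl := Subgroup.map_injective hι hT'
  obtain ⟨g', hg', hgg', -⟩ := hg.symm
  obtain ⟨M', hM'Q, hM'⟩ := hg'.restrict hM
  obtain ⟨g'', hg'', hgg'', hg''g⟩ := hgQ.symm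
  have hg'T : E.IsoOn T' Q g' := hg''.congr fun x hx => by
    obtain ⟨y, hy, rfl⟩ := hgQ.surj hx
    rw [hgg' y (Subgroup.le_normalizer hy), hgg'' y hy]
  exact ⟨M', g' ∘ k, hM'.comp hk, hg'T.comp hkR, hM'Q⟩

theorem exists_extension (hE : E.IsSemisaturated p) (hR : E.IsFullyNormalized R)
    (h : E.IsoOn Q R f) {N : Subgroup P} (hQ : Q ≤ N)
    (hN : N ≤ Subgroup.normalizer (Q : Set P))
    (hy : ∀ x ∈ N, ∃ y, ∀ u ∈ Q, f (x * u * x⁻¹) = y * f u * y⁻¹) :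
    ∃ M g, E.IsoOn N M g ∧ ∀ u ∈ Q, g u = f u := by
  obtain ⟨S, _, _, F, ι, hS, hι, hF, hcl, hres⟩ := hE
  obtain ⟨T, g, hT, hgR, hg⟩ := hres.exists_isoOn_normalizer_normalizer hι hcl hS hF hR
  obtain ⟨M, k, hk, hkf⟩ := hres.exists_extension hι hcl hF hT (hgR.comp h) hQ hN
    fun x hx => by
      obtain ⟨y, hy⟩ := hy x hx
      refine ⟨g y, fun u hu => ?_⟩
      have hyN := h.mem_normalizer (hN hx) hy
      rw [Function.comp_apply, hy u hu, hg.map_conj hyN (Subgroup.le_normalizer (h.mem hu))]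
      rfl
  obtain ⟨g', hg', hgg', -⟩ := hg.symm
  obtain ⟨M', -, hM'⟩ := hg'.restrict
    (hk.le_normalizer hQ hN ((hgR.comp h).congr hkf))
  refine ⟨M', g' ∘ k, hM'.comp hk, fun u hu => ?_⟩
  rw [Function.comp_apply, hkf u hu]
  exact hgg' _ (Subgroup.le_normalizer (h.mem hu))

/-- Transport to an `F`-fully normalized conjugate, where `Aut_S` is Sylow. If a conjugate under `β`
of some `c_x` with `x ∈ P` equals `c_s` with `s ∈ S`, then `x ∈ N_β`, and the extension of `β` sends
`x` to an element inducing the same automorphism as `s`. By strong closure that element lies in `P`,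
even if `s` does not. -/
theorem exists_autP_isStronglyClosedIn (hE : E.IsSemisaturated p) (hQ : E.IsFullyNormalized Q) :
    ∃ T : Sylow p (E.Aut Q), (E.autP Q).IsStronglyClosedIn (T : Subgroup (E.Aut Q)) := by
  obtain ⟨S, _, _, F, ι, hS, hι, hF, hcl, hres⟩ := hE
  obtain ⟨R, g, hR, hgQ, hg⟩ := hres.exists_isoOn_normalizer_normalizer hι hcl hS hF hQ
  obtain ⟨e, h1, he⟩ := id hgQ
  let ε : Q ≃* R.map ι := e.trans (R.equivMapOfInjective ι hι)
  have hε : ∀ u : Q, (ε u : S) = ι (g u) := fun u => by rw [he]; rfl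
  have hiff : ∀ a : MulAut Q, a ∈ E.Aut Q ↔ MulAut.congr ε a ∈ F.Aut (R.map ι) := by
    intro a
    have h2 : a ∈ E.Aut Q ↔ MulAut.congr e a ∈ E.Aut R := by
      constructor
      · exact fun ha => E.comp_mem (E.symm_mem e h1) (E.comp_mem (φ := a.toMonoidHom) ha h1)
      · intro ha
        have h2 := E.comp_mem (E.comp_mem (ψ := (MulAut.congr e a).toMonoidHom) h1 ha)
          (E.symm_mem e h1)
        change a.toMonoidHom ∈ E.Hom Q Q
        convert h2 using 1
        ext u
        simp
    rw [h2]
    refine (hres R R (MulAut.congr e a).toMonoidHom).trans ?_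
    have h3 : ∀ u : R, ((MulAut.congr ε a ⟨ι u, Subgroup.mem_map_of_mem ι u.2⟩ : R.map ι) : S)
        = ι (MulAut.congr e a u) := fun u => by
      have : (⟨ι u, Subgroup.mem_map_of_mem ι u.2⟩ : R.map ι) =
        R.equivMapOfInjective ι hι u := rfl
      rw [this]
      simp [ε]
    constructor
    · rintro ⟨ψ, hψ, hψ'⟩
      change (MulAut.congr ε a).toMonoidHom ∈ F.Hom (R.map ι) (R.map ι)
      convert hψ using 1
      ext ⟨_, u, hu, rfl⟩
      exact (h3 ⟨u, hu⟩).trans (hψ' ⟨u, hu⟩).symm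
    · exact fun h => ⟨_, h, h3⟩
  obtain ⟨T, hT⟩ := exists_sylow_of_equiv ε hiff (hF.exists_sylow_eq_autP hS _ hR)
  refine ⟨T, ?_, ?_⟩
  · intro a ha
    obtain ⟨x, hx, hxa⟩ := mem_autP_iff.1 ha
    refine (hT a).2 ⟨ι (g x), (apply_mem_normalizer_map_iff hι).2 (hg.mem hx), fun u => ?_⟩
    rw [hε, hε, hxa, hg.map_conj hx (Subgroup.le_normalizer u.2)]
    simp
  · intro a ha b hb
    obtain ⟨x, hx, hxa⟩ := mem_autP_iff.1 ha
    obtain ⟨s, hs, hsb⟩ := (hT _).1 hb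
    obtain ⟨β, hβ, hβ'⟩ := exists_isoOn_of_equiv (F := F)
      (e := MulAut.congr ε (b⁻¹ : E.Aut Q)) ((hiff _).1 (b⁻¹).2)
    have hβε : ∀ u : Q, β (ε u) = ε (((b⁻¹ : E.Aut Q) : MulAut Q) u) := fun u => by
      rw [hβ']
      simp
    have hxR : ι (g x) ∈ Subgroup.normalizer (R.map ι : Set S) :=
      (apply_mem_normalizer_map_iff hι).2 (hg.mem hx)
    have hxε : ∀ u : Q, ι (g x) * ε u * (ι (g x))⁻¹ = ε ((a : MulAut Q) u) := fun u => by
      rw [hε, hε, hxa, hg.map_conj hx (Subgroup.le_normalizer u.2)]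
      simp
    have hβs : ∀ r ∈ R.map ι, β (ι (g x) * r * (ι (g x))⁻¹) = s * β r * s⁻¹ := by
      intro r hr
      obtain ⟨u, hu⟩ := ε.surjective ⟨r, hr⟩
      obtain rfl : (ε u : S) = r := congrArg Subtype.val hu
      rw [hxε, hβε, hβε, ← hsb]
      simp
    have hβN := fun n => mem_extNormalizer_iff (hiff _ |>.1 (b⁻¹).2) hβ' (x := n)
    obtain ⟨M, k, hk, hkβ⟩ := hF.exists_extension hR hβ (Subgroup.le_extNormalizer _)
      (fun n hn => ((hβN n).1 hn).1) fun n hn => ((hβN n).1 hn).2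
    have hxN := (hβN _).2 ⟨hxR, s, hβs⟩
    obtain ⟨z, hz⟩ := hcl.mem_of_isoOn hk hxN ⟨g x, rfl⟩
    have hkx : ∀ r ∈ R.map ι, β (ι (g x) * r * (ι (g x))⁻¹) = ι z * β r * (ι z)⁻¹ := by
      intro r hr
      rw [hz, ← hkβ r hr, ← hkβ _ ((Subgroup.mem_normalizer_iff.1 hxR r).1 hr),
        hk.map_conj hxN (Subgroup.le_extNormalizer _ hr)]
    obtain ⟨w, hw, rfl⟩ :=
      hg.surj ((apply_mem_normalizer_map_iff hι).1 (hβ.mem_normalizer hxR hkx))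
    refine mem_autP_iff.2 ⟨w, hw, fun u => ?_⟩
    have hwu : w * u * w⁻¹ ∈ Q := (Subgroup.mem_normalizer_iff.1 hw u).1 u.2
    refine hgQ.injOn (Subtype.prop _) hwu (hι ?_)
    rw [hg.map_conj hw (Subgroup.le_normalizer u.2), ← hε, hsb]
    obtain ⟨r, hr, hru⟩ := hβ.surj (ε u).2
    rw [← hru, ← hβs r hr, hkx r hr, hru, hε]
    simp

end IsSemisaturated

end FusionSystem

/-! ### Strongly embedded subgroups of a finite group -/

namespace Subgroup

variable {p : ℕ} {G : Type u} [Group G] {D H U : Subgroup G}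

theorem mem_conjBy {g x : G} : x ∈ D.conjBy g ↔ g * x * g⁻¹ ∈ D := by
  constructor
  · rintro ⟨d, hd, rfl⟩
    simpa [mul_assoc] using hd
  · intro h
    exact ⟨_, h, by simp [mul_assoc]⟩

theorem conjBy_one : D.conjBy 1 = D := by
  ext x
  simp [mem_conjBy]

theorem ne_bot_of_le (hU : U ≠ ⊥) (h : U ≤ D) : D ≠ ⊥ := by
  rintro rfl
  exact hU (le_bot_iff.1 h)

/-- The subgroup generated by the `g` with `D ∩ D ^ g > 1` is strongly `D`-embedded as soon as it
is proper. -/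
theorem isStronglyEmbedded_closure [Finite G] [Fact p.Prime]
    (hD : ∃ S : Sylow p G, D.IsStronglyClosedIn (S : Subgroup G)) (hne : D ≠ ⊥)
    (htop : closure {g | D ⊓ D.conjBy g ≠ ⊥} ≠ ⊤) :
    IsStronglyEmbedded p D (closure {g | D ⊓ D.conjBy g ≠ ⊥}) := by
  obtain ⟨S, hDS, hcl⟩ := id hD
  set K := closure {g | D ⊓ D.conjBy g ≠ ⊥} with hK
  -- `S` normalizes `D` by strong closure, so each `s ∈ S` satisfies `D ∩ D^s = D > 1`.
  have hSK : (S : Subgroup G) ≤ K := fun s hs => subset_closure <| ne_bot_of_le hne <|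
    le_inf le_rfl fun d hd => mem_conjBy.2 <| by
      have := hcl d hd s⁻¹
      rw [inv_inv] at this
      exact this (mul_mem (mul_mem hs (hDS hd)) (inv_mem hs))
  -- By Sylow's theorem in `K`, some `k ∈ K` moves `U^x` into `S`, hence into `D` by strong closure;
  -- then `k * x⁻¹` is a generator of `K`. Applied to `x` and `x * g⁻¹`, this puts `g` in `K`.
  have key : ∀ U ≤ D, U ≠ ⊥ → ∀ x, U.conjBy x ≤ K → x ∈ K := by
    intro U hU hUne x hx
    have hp : IsPGroup p (U.conjBy x) := (S.2.to_le (hU.trans hDS)).map _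
    obtain ⟨S₁, hS₁⟩ := (hp.comap_of_injective K.subtype K.subtype_injective).exists_le_sylow
    obtain ⟨k, hk⟩ := MulAction.exists_smul_eq K S₁ (S.subtype hSK)
    have h1 : ∀ v ∈ U.conjBy x, (k : G) * v * (k : G)⁻¹ ∈ S := fun v hv => by
      have h2 : k * ⟨v, hx hv⟩ * k⁻¹ ∈ S.subtype hSK := by
        rw [← hk]
        exact smul_mem_pointwise_smul _ (MulAut.conj k) _ (hS₁ (x := ⟨v, hx hv⟩) hv)
      exact h2
    have h3 : (k : G) * x⁻¹ ∈ K := subset_closure <| ne_bot_of_le hUne <| le_inf hU fun u hu => by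
      have h4 := h1 (x⁻¹ * u * x) (mem_conjBy.2 (by simpa [mul_assoc] using hu))
      have h5 := hcl u (hU hu) (x * (k : G)⁻¹)
      rw [mem_conjBy]
      simp only [mul_inv_rev, inv_inv, mul_assoc] at h4 h5 ⊢
      exact h5 h4
    have h6 : x⁻¹ ∈ K := by simpa using mul_mem (inv_mem k.2) h3
    simpa using inv_mem h6
  refine ⟨hD, hne, htop, ⟨1, ?_⟩, fun g hg U hU hUne x hx => hg ?_⟩
  · rw [conjBy_one]
    exact hDS.trans hSK
  · have h1 := key U hU hUne x (hx.trans inf_le_left)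
    have h2 := key U hU hUne (x * g⁻¹) fun v hv => by
      have h3 : g⁻¹ * v * g ∈ U.conjBy x := by
        rw [mem_conjBy] at hv ⊢
        simpa [mul_assoc] using hv
      simpa [mul_assoc] using mem_conjBy.1 (hx h3).2
    have h4 : g⁻¹ ∈ K := by simpa using mul_mem (inv_mem h1) h2
    simpa using inv_mem h4

/-- With `D^x ≤ H`, a nontrivial `D ∩ D^g` has its `x`-conjugate inside `H ∩ H^(x⁻¹gx)`, forcing
`x⁻¹gx ∈ H`. So all generators lie in one conjugate of the proper subgroup `H`. -/
theorem IsStronglyEmbedded.closure_ne_top (h : IsStronglyEmbedded p D H) :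
    closure {g | D ⊓ D.conjBy g ≠ ⊥} ≠ ⊤ := by
  obtain ⟨x, hx⟩ := h.exists_conj_le
  have hle : closure {g | D ⊓ D.conjBy g ≠ ⊥} ≤ H.conjBy x⁻¹ := by
    rw [closure_le]
    intro g hg
    have : x⁻¹ * g * x ∈ H := by
      by_contra hgx
      refine h.not_conj_le _ hgx _ inf_le_left hg x (le_inf ?_ ?_)
      · intro v hv
        exact hx (mem_conjBy.2 (mem_conjBy.1 hv).1)
      · intro v hv
        have h1 := mem_conjBy.1 (mem_conjBy.1 hv).2
        rw [mem_conjBy]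
        apply hx
        rw [mem_conjBy]
        simpa [mul_assoc] using h1
    simpa [mem_conjBy] using this
  intro htop
  apply h.ne_top
  rw [htop, top_le_iff] at hle
  rw [eq_top_iff']
  intro y
  have : x * y * x⁻¹ ∈ H.conjBy x⁻¹ := hle ▸ mem_top _
  simpa [mem_conjBy, mul_assoc] using this

theorem le_opCore {N : Subgroup G} [N.Normal] (hN : IsPGroup p N) : N ≤ opCore p G :=
  le_sSup ⟨inferInstance, hN⟩

theorem opCore_le_sylow (S : Sylow p G) : opCore p G ≤ S :=
  sSup_le fun _ ⟨_, hN⟩ => hN.le_sylow_of_normal S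

theorem opCore_normal : (opCore p G).Normal := by
  rw [opCore, sSup_eq_iSup']
  have : ∀ N : {N : Subgroup G | N.Normal ∧ IsPGroup p N}, (N : Subgroup G).Normal :=
    fun N => N.2.1
  infer_instance

/-- Conjugates of `D ∩ O_p(G)` stay in `O_p(G) ≤ S`, hence in `D`; were it nontrivial, every `g`
would be a generator. -/
theorem inf_opCore_eq_bot (hD : ∃ S : Sylow p G, D.IsStronglyClosedIn (S : Subgroup G))
    (htop : closure {g | D ⊓ D.conjBy g ≠ ⊥} ≠ ⊤) : D ⊓ opCore p G = ⊥ := by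
  obtain ⟨S, hDS, hcl⟩ := hD
  by_contra hne
  refine htop (eq_top_iff.2 fun g _ => subset_closure <| ne_bot_of_le hne <|
    le_inf inf_le_left fun d hd => mem_conjBy.2 ?_)
  have h1 := opCore_normal.conj_mem d hd.2 g
  have h2 := hcl d hd.1 g⁻¹
  rw [inv_inv] at h2
  exact h2 (opCore_le_sylow S h1)

theorem IsStronglyClosedIn.map_mk' [Finite G] [Fact p.Prime] {N : Subgroup G} [N.Normal]
    {S : Sylow p G} (h : D.IsStronglyClosedIn (S : Subgroup G)) (hN : N ≤ D) :
    ∃ T : Sylow p (G ⧸ N), (D.map (QuotientGroup.mk' N)).IsStronglyClosedIn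
      (T : Subgroup (G ⧸ N)) := by
  refine ⟨S.mapSurjective (QuotientGroup.mk'_surjective N), map_mono h.1, ?_⟩
  rintro _ ⟨d, hd, rfl⟩ g hg
  obtain ⟨g, rfl⟩ := QuotientGroup.mk'_surjective N g
  rw [← map_inv, ← map_mul, ← map_mul] at hg ⊢
  refine mem_map_of_mem _ (h.2 d hd g ?_)
  have h1 : g⁻¹ * d * g ∈ ((S : Subgroup G).map (QuotientGroup.mk' N)).comap
    (QuotientGroup.mk' N) := hg
  rwa [comap_map_eq_self] at h1
  rw [QuotientGroup.ker_mk']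
  exact hN.trans h.1

end Subgroup

/-! ### Outer automorphisms and essential subgroups -/

namespace FusionSystem

variable {p : ℕ} {P : Type u} [Group P] {E : FusionSystem P} {Q R : Subgroup P} {f g : P → P}

theorem mem_innAut_iff {a : E.Aut Q} : a ∈ E.innAut Q ↔
    ∃ x ∈ Q, ∀ u : Q, ((a : MulAut Q) u : P) = x * u * x⁻¹ := by
  constructor
  · rintro ⟨x, hx⟩
    exact ⟨x, x.2, fun u => (congrArg (fun b : MulAut Q => (b u : P)) hx).symm⟩
  · rintro ⟨x, hx, h⟩
    refine ⟨⟨x, hx⟩, ?_⟩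
    ext u
    exact (h u).symm

theorem innAut_le_autP (E : FusionSystem P) (Q : Subgroup P) : E.innAut Q ≤ E.autP Q := by
  intro a ha
  obtain ⟨x, hx, h⟩ := mem_innAut_iff.1 ha
  exact mem_autP_iff.2 ⟨x, Subgroup.le_normalizer hx, h⟩

theorem mk_mem_outP_iff {a : E.Aut Q} : QuotientGroup.mk' (E.innAut Q) a ∈ E.outP Q ↔
    a ∈ E.autP Q := by
  have : (E.outP Q).comap (QuotientGroup.mk' (E.innAut Q)) = E.autP Q :=
    Subgroup.comap_map_eq_self (by rw [QuotientGroup.ker_mk']; exact E.innAut_le_autP Q)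
  rw [← Subgroup.mem_comap, this]

theorem mem_of_conj_mem_innAut (hc : Subgroup.centralizer (Q : Set P) ≤ Q) {a : E.Aut Q}
    (ha : a ∈ E.innAut Q) {x : P} (hx : ∀ u : Q, ((a : MulAut Q) u : P) = x * u * x⁻¹) :
    x ∈ Q := by
  obtain ⟨q, hq, h⟩ := mem_innAut_iff.1 ha
  have h1 : q⁻¹ * x ∈ Q := hc <| Subgroup.mem_centralizer_iff.2 fun u hu => by
    have h2 := (hx ⟨u, hu⟩).symm.trans (h ⟨u, hu⟩)
    have h3 : x * u = q * u * q⁻¹ * x := by rw [← h2]; group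
    rw [mul_assoc q⁻¹, h3]
    group
  simpa using mul_mem hq h1

theorem lt_extNormalizer_iff (hc : Subgroup.centralizer (Q : Set P) ≤ Q) (φ : E.Aut Q) :
    Q < Subgroup.extNormalizer (φ : MulAut Q).toMonoidHom ↔
      E.outP Q ⊓ (E.outP Q).conjBy (QuotientGroup.mk' (E.innAut Q) φ) ≠ ⊥ := by
  obtain ⟨f, hf, hfφ⟩ := exists_isoOn_of_aut φ
  have hmem : ∀ x, x ∈ Subgroup.extNormalizer (φ : MulAut Q).toMonoidHom ↔
    x ∈ Subgroup.normalizer (Q : Set P) ∧ ∃ y, ∀ u ∈ Q, f (x * u * x⁻¹) = y * f u * y⁻¹ :=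
    fun x => mem_extNormalizer_iff φ.2 hfφ
  constructor
  · intro hlt
    obtain ⟨x, hx, hxQ⟩ := SetLike.exists_of_lt hlt
    obtain ⟨hxN, y, hy⟩ := (hmem x).1 hx
    obtain ⟨a, ha, hax⟩ := E.exists_mem_autP hxN
    refine Subgroup.ne_bot_iff_exists_ne_one.2 ⟨⟨QuotientGroup.mk' _ a, mk_mem_outP_iff.2 ha,
      Subgroup.mem_conjBy.2 ?_⟩, fun h => hxQ ?_⟩
    · rw [← map_inv, ← map_mul, ← map_mul]
      refine mk_mem_outP_iff.2 (mem_autP_iff.2 ⟨y, hf.mem_normalizer hxN hy, fun u => ?_⟩)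
      have h1 := hy _ (((φ⁻¹ : E.Aut Q) : MulAut Q) u).2
      rw [← hax, hfφ, hfφ] at h1
      simpa using h1
    · refine mem_of_conj_mem_innAut hc ?_ hax
      exact (QuotientGroup.eq_one_iff a).1 (congrArg Subtype.val h)
  · intro hne
    obtain ⟨⟨z, hz, hz'⟩, hz1⟩ := Subgroup.ne_bot_iff_exists_ne_one.1 hne
    obtain ⟨a, rfl⟩ := QuotientGroup.mk'_surjective _ z
    replace hz' := Subgroup.mem_conjBy.1 hz'
    rw [← map_inv, ← map_mul, ← map_mul, mk_mem_outP_iff] at hz'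
    obtain ⟨x, hx, hax⟩ := mem_autP_iff.1 (mk_mem_outP_iff.1 hz)
    obtain ⟨y, hy, hay⟩ := mem_autP_iff.1 hz'
    refine lt_of_le_not_ge (Subgroup.le_extNormalizer _) fun hle => hz1 <| Subtype.ext <|
      (QuotientGroup.eq_one_iff a).2 <| mem_innAut_iff.2 ⟨x, hle ((hmem x).2 ⟨hx, y, ?_⟩), hax⟩
    intro u hu
    have h1 := hay ((φ : MulAut Q) ⟨u, hu⟩)
    rw [← hax ⟨u, hu⟩, hfφ, hfφ ⟨u, hu⟩, ← h1]
    simp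

theorem comap_intersectOut (hc : Subgroup.centralizer (Q : Set P) ≤ Q) (hne : E.outP Q ≠ ⊥) :
    (E.intersectOut Q).comap (QuotientGroup.mk' (E.innAut Q)) = E.extAut Q := by
  have hset : QuotientGroup.mk' (E.innAut Q) ''
      {φ | Q < Subgroup.extNormalizer (φ : MulAut Q).toMonoidHom} =
      {φ | E.outP Q ⊓ (E.outP Q).conjBy φ ≠ ⊥} := by
    ext z
    constructor
    · rintro ⟨φ, hφ, rfl⟩
      exact (lt_extNormalizer_iff hc φ).1 hφ
    · intro hz
      obtain ⟨φ, rfl⟩ := QuotientGroup.mk'_surjective _ z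
      exact ⟨φ, (lt_extNormalizer_iff hc φ).2 hz, rfl⟩
  have hmap : (E.extAut Q).map (QuotientGroup.mk' (E.innAut Q)) = E.intersectOut Q := by
    rw [extAut, MonoidHom.map_closure, hset, intersectOut]
  rw [← hmap]
  refine Subgroup.comap_map_eq_self ?_
  rw [QuotientGroup.ker_mk']
  intro a ha
  -- Inner automorphisms are trivial in `Out_E(Q)`; the identity is among the generators precisely
  -- because `Out_P(Q) > 1`.
  refine Subgroup.subset_closure ((lt_extNormalizer_iff hc a).2 ?_)
  rw [show QuotientGroup.mk' (E.innAut Q) a = 1 from (QuotientGroup.eq_one_iff a).2 ha,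
    Subgroup.conjBy_one, inf_idem]
  exact hne

theorem extAut_eq_top_iff (hc : Subgroup.centralizer (Q : Set P) ≤ Q) (hne : E.outP Q ≠ ⊥) :
    E.extAut Q = ⊤ ↔ E.intersectOut Q = ⊤ := by
  rw [← comap_intersectOut hc hne, ← Subgroup.comap_top (QuotientGroup.mk' (E.innAut Q))]
  exact (Subgroup.comap_injective (QuotientGroup.mk'_surjective _)).eq_iff

/-- Normalizers grow in `p`-groups, and an element of `N_P(Q)` outside `Q` is not inner because
`C_P(Q) ≤ Q`. -/
theorem outP_ne_bot [Finite P] [Fact p.Prime] (hP : IsPGroup p P) (hQ : Q ≠ ⊤)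
    (hc : Subgroup.centralizer (Q : Set P) ≤ Q) : E.outP Q ≠ ⊥ := by
  have : Group.IsNilpotent P := hP.isNilpotent
  obtain ⟨x, hx, hxQ⟩ := SetLike.exists_of_lt
    (Group.normalizerCondition_of_isNilpotent Q (lt_top_iff_ne_top.2 hQ))
  obtain ⟨a, ha, hax⟩ := E.exists_mem_autP hx
  intro h
  have h1 := mk_mem_outP_iff.2 ha
  rw [h, Subgroup.mem_bot] at h1
  exact hxQ (mem_of_conj_mem_innAut hc ((QuotientGroup.eq_one_iff a).1 h1) hax)

theorem outP_top : E.outP ⊤ = ⊥ := by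
  rw [eq_bot_iff]
  rintro _ ⟨a, ha, rfl⟩
  obtain ⟨x, -, hx⟩ := mem_autP_iff.1 ha
  exact (QuotientGroup.eq_one_iff a).2 (mem_innAut_iff.2 ⟨x, trivial, hx⟩)

theorem centralizer_le_of_extAut_ne_top (h : E.extAut Q ≠ ⊤) :
    Subgroup.centralizer (Q : Set P) ≤ Q := by
  by_contra hc
  obtain ⟨x, hx, hxQ⟩ := SetLike.not_le_iff_exists.1 hc
  have hxu : ∀ u ∈ Q, x * u * x⁻¹ = u := fun u hu => by
    rw [← Subgroup.mem_centralizer_iff.1 hx u hu, mul_inv_cancel_right]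
  refine h (eq_top_iff.2 fun φ _ => Subgroup.subset_closure <|
    lt_of_le_not_ge (Subgroup.le_extNormalizer _) fun hle => hxQ (hle ?_))
  obtain ⟨f, hf, hfφ⟩ := exists_isoOn_of_aut φ
  refine (mem_extNormalizer_iff φ.2 hfφ).2
    ⟨Subgroup.centralizer_le_normalizer _ hx, 1, fun u hu => by simp [hxu u hu]⟩

/-- The image of the core in `Out_E(Q)` is a normal `p`-subgroup inside `Out_P(Q)`, hence trivial.
-/
theorem innAut_eq_normalCore (hP : IsPGroup p P)
    (h : E.outP Q ⊓ Subgroup.opCore p (E.Out Q) = ⊥) :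
    E.innAut Q = (E.autP Q).normalCore := by
  refine le_antisymm (Subgroup.normal_le_normalCore.2 (E.innAut_le_autP Q)) fun a ha => ?_
  have hN : ((E.autP Q).normalCore.map (QuotientGroup.mk' (E.innAut Q))).Normal :=
    (E.autP Q).normalCore_normal.map _ (QuotientGroup.mk'_surjective _)
  have hp : IsPGroup p ((E.autP Q).normalCore.map (QuotientGroup.mk' (E.innAut Q))) :=
    ((isPGroup_autP hP E Q).to_le (Subgroup.normalCore_le _)).map _
  have h1 : QuotientGroup.mk' (E.innAut Q) a ∈ E.outP Q ⊓ Subgroup.opCore p (E.Out Q) :=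
    ⟨mk_mem_outP_iff.2 (Subgroup.normalCore_le _ ha),
      Subgroup.le_opCore hp (Subgroup.mem_map_of_mem _ ha)⟩
  rw [h, Subgroup.mem_bot] at h1
  exact (QuotientGroup.eq_one_iff a).1 h1

variable [Finite P] [Fact p.Prime]

/-- An isomorphism `R → Q` extending to `N_P(R)` carries `C_P(R)` into `C_P(Q) ≤ Q`. -/
theorem IsSemisaturated.isCentric (hE : E.IsSemisaturated p) (hQ : E.IsFullyNormalized Q)
    (hc : Subgroup.centralizer (Q : Set P) ≤ Q) : E.IsCentric Q := by
  intro R hR x hx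
  obtain ⟨f, hf⟩ := isConj_iff.1 hR
  obtain ⟨f', hf', -⟩ := hf.symm
  obtain ⟨M, g, hg, hgR, -⟩ := hE.exists_isoOn_normalizer hQ hf'
  have hxN : x ∈ Subgroup.normalizer (R : Set P) := Subgroup.centralizer_le_normalizer _ hx
  have hgx : g x ∈ Q := hc <| Subgroup.mem_centralizer_iff.2 fun v hv => by
    obtain ⟨r, hr, rfl⟩ := hgR.surj hv
    have hrN := Subgroup.le_normalizer (H := R) hr
    rw [← hg.map_mul hrN hxN, ← hg.map_mul hxN hrN, Subgroup.mem_centralizer_iff.1 hx r hr]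
  obtain ⟨r, hr, hrx⟩ := hgR.surj hgx
  rwa [← hg.injOn (Subgroup.le_normalizer hr) hxN hrx]

theorem IsSemisaturated.isReceptive (hE : E.IsSemisaturated p) (hQ : E.IsFullyNormalized Q) :
    E.IsReceptive Q := by
  intro R φ hφ
  obtain ⟨f, hf, hfφ⟩ := exists_isoOn_of_equiv hφ
  have hmem := fun x => mem_extNormalizer_iff hφ hfφ (x := x)
  obtain ⟨M, g, ⟨e, h1, he⟩, hgf⟩ := hE.exists_extension hQ hf (Subgroup.le_extNormalizer _)
    (fun x hx => ((hmem x).1 hx).1) fun x hx => ((hmem x).1 hx).2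
  refine ⟨(Subgroup.inclusion le_top).comp e.toMonoidHom,
    E.comp_mem h1 (E.conj_mem 1 _ fun u => by simp), fun u => ?_⟩
  exact (he ⟨u, Subgroup.le_extNormalizer _ u.2⟩).symm.trans ((hgf u u.2).trans (hfφ u))

theorem IsSemisaturated.isReproductive (hP : IsPGroup p P) (hE : E.IsSemisaturated p)
    (hQ : E.IsFullyNormalized Q) (hQt : Q ≠ ⊤) : E.IsReproductive Q := by
  refine ⟨hQt, hE.isReceptive hQ, fun R hR => ?_⟩
  obtain ⟨f, hf⟩ := isConj_iff.1 hR
  obtain ⟨f', hf', -⟩ := hf.symm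
  obtain ⟨M, g, hg, ⟨e, h1, he⟩, -⟩ := hE.exists_isoOn_normalizer hQ hf'
  have hRt : R < ⊤ := by
    rw [lt_top_iff_ne_top]
    rintro rfl
    exact hQt (Subgroup.eq_top_of_card_eq _ (hf.card_eq.trans Subgroup.card_top))
  have : Group.IsNilpotent P := hP.isNilpotent
  exact ⟨e.toMonoidHom, h1, (Group.normalizerCondition_of_isNilpotent R hRt).trans_le fun x hx =>
    (mem_extNormalizer_iff h1 he).2
      ⟨hx, g x, fun u hu => hg.map_conj hx (Subgroup.le_normalizer hu)⟩⟩

theorem IsSemisaturated.exists_outP_isStronglyClosedIn (hE : E.IsSemisaturated p)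
    (hQ : E.IsFullyNormalized Q) :
    ∃ T : Sylow p (E.Out Q), (E.outP Q).IsStronglyClosedIn (T : Subgroup (E.Out Q)) := by
  obtain ⟨T, hT⟩ := hE.exists_autP_isStronglyClosedIn hQ
  exact hT.map_mk' (E.innAut_le_autP Q)

end FusionSystem

theorem mainTheorem9 {p : ℕ} [Fact p.Prime] {P : Type u} [Group P] [Finite P]
    (hP : IsPGroup p P) (E : FusionSystem P) (hE : E.IsSemisaturated p)
    (Q : Subgroup P) (hQ : E.IsFullyNormalized Q) :
    (E.IsEssential Q →
      E.IsCentric Q ∧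
      Subgroup.IsStronglyEmbedded p (E.outP Q) (E.intersectOut Q) ∧
      E.outP Q ⊓ Subgroup.opCore p (E.Out Q) = ⊥ ∧
      E.innAut Q = (E.autP Q).normalCore) ∧
    (E.IsCentric Q →
      (E.IsEssential Q ↔
        ∃ H : Subgroup (E.Out Q), Subgroup.IsStronglyEmbedded p (E.outP Q) H)) := by
  have hT := hE.exists_outP_isStronglyClosedIn hQ
  have h1 : E.IsEssential Q → E.IsCentric Q ∧
      Subgroup.IsStronglyEmbedded p (E.outP Q) (E.intersectOut Q) ∧
      E.outP Q ⊓ Subgroup.opCore p (E.Out Q) = ⊥ ∧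
      E.innAut Q = (E.autP Q).normalCore := by
    intro hess
    have hc := FusionSystem.centralizer_le_of_extAut_ne_top hess.extAut_ne_top
    have hne : E.outP Q ≠ ⊥ := FusionSystem.outP_ne_bot hP hess.reproductive.ne_top hc
    have htop : E.intersectOut Q ≠ ⊤ := fun h =>
      hess.extAut_ne_top ((FusionSystem.extAut_eq_top_iff hc hne).2 h)
    have hO := Subgroup.inf_opCore_eq_bot hT htop
    exact ⟨hE.isCentric hQ hc, Subgroup.isStronglyEmbedded_closure hT hne htop, hO,
      FusionSystem.innAut_eq_normalCore hP hO⟩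
  refine ⟨h1, fun hcent => ⟨fun h => ⟨_, (h1 h).2.1⟩, ?_⟩⟩
  rintro ⟨H, hH⟩
  have hc := hcent Q (E.isoOn_id Q).isConj
  refine ⟨hE.isReproductive hP hQ ?_, fun h => hH.closure_ne_top
    ((FusionSystem.extAut_eq_top_iff hc hH.ne_bot).1 h)⟩
  -- `Q = P` is impossible, since `Out_P(P)` is trivial while strong embedding requires it not to
  -- be.
  rintro rfl
  exact hH.ne_bot FusionSystem.outP_top
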